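/- All vector spaces are real; a cone is a commutative monoid $Y$ with a scalar multiplication by $[0,\infty)$ satisfying the usual module axioms. An asymmetric seminorm on a vector space $X$ is a function $p:X\to[0,\infty)$ with $p(rx)=r\,p(x)$ for $r\ge 0$ and $p(x+y)\le p(x)+p(y)$. A family $\mathcal P$ of asymmetric seminorms induces the topology on $X$ with basis $\{y\in X: p(y-x)<\varepsilon \text{ for all } p\in F\}$, where $x\in X$, $\varepsilon>0$ and $F\subseteq\mathcal P$ is finite; topologies of this form are called asymmetric locally convex. The dual $(X,\alpha)^*$ of $X$ with a topology $\alpha$ is the cone of all linear $\alpha$-upper semicontinuous functions $X\to\mathbb R$. A vector space $X$ and a cone $Y$ are in duality if they are equipped with a map $\langle\cdot,\cdot\rangle:X\times Y\to\mathbb R$ that is linear in the first variable, additive and homogeneous with respect to nonnegative scalars in the second variable, and nondegenerate: $\langle x,\cdot\rangle=0$ implies $x=0$, and $\langle\cdot,y\rangle=\langle\cdot,z\rangle$ implies $y=z$. Then $\sigma(X,Y)$ is the topology on $X$ induced by the asymmetric seminorms $p_y(x)=\max\{\langle x,y\rangle,0\}$, $y\in Y$; $\sigma(Y,X)$ is the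 topology on $Y$ of pointwise convergence on $X$; and the Mackey topology $\tau(X,Y)$ is the topology on $X$ induced by the asymmetric seminorms $p_B(x)=\sup_{y\in B}\max\{\langle x,y\rangle,0\}$ (with $p_\emptyset=0$), where $B$ ranges over the convex $\sigma(Y,X)$-compact subsets of $Y$. We say that $\alpha$ has dual $Y$, and write $(X,\alpha)^*=Y$, if $y\mapsto\langle\cdot,y\rangle$ is a bijection of $Y$ onto $(X,\alpha)^*$. **Theorem.** Let $X$ and $Y$ be in duality. 1. $\tau(X,Y)$ is the finest $T_0$ asymmetric locally convex topology on $X$ with dual $Y$; in particular it is itself a $T_0$ asymmetric locally convex topology and $(X,\tau(X,Y))^*=Y$. 2. If $\alpha$ is a $T_0$ asymmetric locally convex topology on $X$ with $\sigma(X,Y)\subseteq\alpha\subseteq\tau(X,Y)$, then $(X,\alpha)^*=Y$. Moreover, let $X$ be any vector space with a $T_0$ asymmetric locally convex topology $\alpha$, and put $X^*=(X,\alpha)^*$. 3. $X$ and $X^*$ are in duality under $\langle x,\phi\rangle=\phi(x)$, and $\sigma(X,X^*)\subseteq\alpha\subseteq\tau(X,X^*)$. -/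

import Mathlib

open scoped NNReal

noncomputable section

namespace AsymDuality

/-- Asymmetric seminorms on a real vector space: nonnegative, positively homogeneous, subadditive. -/
structure IsAsymmetricSeminorm {X : Type*} [AddCommGroup X] [Module ℝ X] (p : X → ℝ) : Prop where
  nonneg : ∀ x, 0 ≤ p x
  smul : ∀ r : ℝ, 0 ≤ r → ∀ x, p (r • x) = r * p x
  add_le : ∀ x y, p (x + y) ≤ p x + p y

/-- The topology `τ_P` with basis the sets `{y | ∀ p ∈ F, p (y - x) < ε}`, for `x : X`, `F ⊆ P`
finite and `ε > 0`. -/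
def seminormTopology {X : Type*} [AddCommGroup X] (P : Set (X → ℝ)) : TopologicalSpace X :=
  TopologicalSpace.generateFrom
    {U | ∃ (x : X) (F : Set (X → ℝ)) (ε : ℝ), F.Finite ∧ F ⊆ P ∧ 0 < ε ∧
      U = {y | ∀ p ∈ F, p (y - x) < ε}}

/-- Asymmetric locally convex topologies: those induced by a family of asymmetric seminorms. -/
def IsAsymmetricLocallyConvex {X : Type*} [AddCommGroup X] [Module ℝ X]
    (α : TopologicalSpace X) : Prop :=
  ∃ P : Set (X → ℝ), (∀ p ∈ P, IsAsymmetricSeminorm p) ∧ α = seminormTopology P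

/-- The dual `(X, α)^*`: the cone of all linear, upper semicontinuous functions `X → ℝ`. -/
def dualCone {X : Type*} [AddCommGroup X] [Module ℝ X] (α : TopologicalSpace X) :
    Submodule ℝ≥0 (Module.Dual ℝ X) where
  carrier := {φ | @UpperSemicontinuous X ℝ α _ (fun x => φ x)}
  zero_mem' := by
    intro x a ha
    exact Filter.Eventually.of_forall fun _ => ha
  add_mem' := by
    intro φ ψ hφ hψ
    let _ := α
    exact UpperSemicontinuous.add (f := fun x => φ x) (g := fun x => ψ x) hφ hψ
  smul_mem' := by
    intro c φ hφ x a ha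
    let _ := α
    change ∀ᶠ x' in nhds x, (c : ℝ) * φ x' < a
    have ha' : (c : ℝ) * φ x < a := ha
    rcases eq_or_lt_of_le c.2 with h | h
    · have h0 : (c : ℝ) = 0 := h.symm
      rw [h0, zero_mul] at ha'
      exact Filter.Eventually.of_forall fun y => by rw [h0, zero_mul]; exact ha'
    · have h0 : (0 : ℝ) < (c : ℝ) := h
      have hx : φ x < a / c := by rw [lt_div_iff₀ h0, mul_comm]; exact ha'
      filter_upwards [hφ x (a / c) hx] with y hy
      have hy' : φ y < a / c := hy
      rw [lt_div_iff₀ h0, mul_comm] at hy'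
      exact hy'

section Pairing

variable {X Y : Type*} [AddCommGroup X] [Module ℝ X] [AddCommMonoid Y] [Module ℝ≥0 Y]

/-- A vector space `X` and a cone `Y` (a module over the nonnegative reals) are in duality by means
of the pairing `b`, if `b` is nondegenerate in the following sense. -/
structure IsAsymmetricDualPair (b : X →ₗ[ℝ] Y →ₗ[ℝ≥0] ℝ) : Prop where
  left : ∀ x, (∀ y, b x y = 0) → x = 0
  right : ∀ y z, (∀ x, b x y = b x z) → y = z

/-- `σ(X, Y)`: the topology on `X` induced by the asymmetric seminorms `x ↦ max (b x y) 0`. -/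
def weakTopology (b : X →ₗ[ℝ] Y →ₗ[ℝ≥0] ℝ) : TopologicalSpace X :=
  seminormTopology (Set.range fun (y : Y) (x : X) => max (b x y) 0)

/-- `σ(Y, X)`: the topology on `Y` of pointwise convergence on `X`. -/
def weakStarTopology (b : X →ₗ[ℝ] Y →ₗ[ℝ≥0] ℝ) : TopologicalSpace Y :=
  TopologicalSpace.induced (fun (y : Y) (x : X) => b x y) inferInstance

/-- The supremum `p_B` over `y ∈ B` of `x ↦ max (b x y) 0`, for `B` bounded for `σ(Y, X)`
(it is `0` for empty `B`). -/
def polarSeminorm (b : X →ₗ[ℝ] Y →ₗ[ℝ≥0] ℝ) (B : Set Y) (x : X) : ℝ :=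
  sSup ((fun y => max (b x y) 0) '' B)

/-- The supremum in `polarSeminorm` is a genuine one for all sets compact for `σ(Y, X)`. -/
theorem bddAbove_of_isCompact (b : X →ₗ[ℝ] Y →ₗ[ℝ≥0] ℝ) {B : Set Y}
    (hB : @IsCompact Y (weakStarTopology b) B) (x : X) :
    BddAbove ((fun y => max (b x y) 0) '' B) := by
  let _ := weakStarTopology b
  have hc : Continuous fun (y : Y) (x : X) => b x y := continuous_induced_dom
  have hx : Continuous fun y => max (b x y) 0 :=
    ((continuous_apply x).comp hc).max continuous_const
  exact (hB.image hx).bddAbove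

/-- The topology on `X` induced by the asymmetric seminorms `p_B` with `B ∈ 𝒢`, that is, the
topology of (asymmetric) uniform convergence on the members of `𝒢`. -/
def polarTopology (b : X →ₗ[ℝ] Y →ₗ[ℝ≥0] ℝ) (𝒢 : Set (Set Y)) : TopologicalSpace X :=
  seminormTopology (polarSeminorm b '' 𝒢)

/-- The Mackey topology `τ(X, Y)`. -/
def mackeyTopology (b : X →ₗ[ℝ] Y →ₗ[ℝ≥0] ℝ) : TopologicalSpace X :=
  polarTopology b {B | Convex ℝ≥0 B ∧ @IsCompact Y (weakStarTopology b) B}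

/-- `(X, α)^* = Y`, under the identification of `y : Y` with the function `x ↦ b x y`. -/
def HasDual (b : X →ₗ[ℝ] Y →ₗ[ℝ≥0] ℝ) (α : TopologicalSpace X) : Prop :=
  (∀ φ ∈ dualCone α, ∃! y : Y, b.flip y = φ) ∧ ∀ y : Y, b.flip y ∈ dualCone α

end Pairing

/-- The evaluation pairing `(x, φ) ↦ φ x` of `X` and `(X, α)^*`. -/
def evalPairing {X : Type*} [AddCommGroup X] [Module ℝ X] (α : TopologicalSpace X) :
    X →ₗ[ℝ] dualCone α →ₗ[ℝ≥0] ℝ :=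
  LinearMap.flip (dualCone α).subtype

end AsymDuality

end

namespace AsymDuality

open Topology Pointwise

/-! ### Asymmetric seminorms and their upper semicontinuous functionals. -/

section Seminorms

/-! The dual of a topology grows as the topology gets finer, so everything reduces to two bounds.
All of `Y` lies in the dual exactly when the topology refines σ, whose generating sets are
intersections of open half-spaces given by elements of `Y`. If an asymmetric locally convex topology
has no functionals outside `Y`, it is coarser than τ: by Hahn-Banach each defining seminorm `p`
equals `p_B`, where `B` is the set of `y` dominated by `p`, and `B` is compact by Alaoglu
(`mackeyTopology_le`). Conversely, a τ-upper semicontinuous `φ` is controlled near 0 by finitely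
many `p_B`. These are dominated by the support function of one compact convex set `K` of functionals
from `Y`, and separation puts a positive multiple of `φ` in `K`
(`exists_flip_eq_of_mem_dualCone_mackeyTopology`). Since the cone `Y` has no subtraction, `K` lives
in the algebraic dual of `X`. -/

theorem seminormTopology_anti {X : Type*} [AddCommGroup X] {P Q : Set (X → ℝ)} (h : P ⊆ Q) :
    seminormTopology Q ≤ seminormTopology P := by
  apply TopologicalSpace.generateFrom_anti
  rintro U ⟨x, F, ε, hF, hFP, hε, rfl⟩
  exact ⟨x, F, ε, hF, hFP.trans h, hε, rfl⟩

theorem T0Space.of_le {X : Type*} {α β : TopologicalSpace X} (h : α ≤ β) (hβ : @T0Space X β) :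
    @T0Space X α := by
  refine @T0Space.mk X α fun x z hxz => hβ.t0 ?_
  rw [@inseparable_iff_forall_isOpen X β]
  exact fun U hU => (@inseparable_iff_forall_isOpen X α x z).1 hxz U (h U hU)

variable {X : Type*} [AddCommGroup X] [Module ℝ X] {P : Set (X → ℝ)} {p : X → ℝ}

theorem IsAsymmetricSeminorm.map_zero (hp : IsAsymmetricSeminorm p) : p 0 = 0 := by
  simpa using hp.smul 0 le_rfl 0

/-- The Hahn-Banach theorem: an asymmetric seminorm is at each point attained by a linear function
that it dominates. -/
theorem IsAsymmetricSeminorm.exists_dual_eq (hp : IsAsymmetricSeminorm p) (x : X) :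
    ∃ φ : Module.Dual ℝ X, (∀ z, φ z ≤ p z) ∧ φ x = p x := by
  rcases eq_or_ne x 0 with rfl | hx
  · exact ⟨0, fun z => by simpa using hp.nonneg z, by simp [hp.map_zero]⟩
  · obtain ⟨g, hg, hgp⟩ := exists_extension_of_le_sublinear
      (LinearPMap.mkSpanSingleton x (p x) hx) p (fun c hc z => hp.smul c hc.le z) hp.add_le (by
        rintro ⟨z, hz⟩
        obtain ⟨r, rfl⟩ := Submodule.mem_span_singleton.1 hz
        rw [LinearPMap.mkSpanSingleton'_apply, RingHom.id_apply, smul_eq_mul]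
        rcases le_total 0 r with hr | hr
        · exact (hp.smul r hr x).ge
        · exact (mul_nonpos_of_nonpos_of_nonneg hr (hp.nonneg x)).trans (hp.nonneg _))
    refine ⟨g, hgp, ?_⟩
    have := hg ⟨x, Submodule.mem_span_singleton_self x⟩
    rwa [LinearPMap.mkSpanSingleton_apply] at this

theorem isAsymmetricSeminorm_max_zero (φ : Module.Dual ℝ X) :
    IsAsymmetricSeminorm fun x => max (φ x) 0 where
  nonneg x := le_max_right _ _
  smul r hr x := by
    rw [map_smul, smul_eq_mul, mul_max_of_nonneg _ _ hr, mul_zero]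
  add_le x y := by
    rw [map_add]
    exact max_le (add_le_add (le_max_left _ _) (le_max_left _ _))
      (add_nonneg (le_max_right _ _) (le_max_right _ _))

/-- The sets by which `seminormTopology P` is generated form a basis of it. -/
theorem exists_subset_of_isOpen_seminormTopology (hP : ∀ p ∈ P, IsAsymmetricSeminorm p) {U : Set X}
    (hU : IsOpen[seminormTopology P] U) {x : X} (hx : x ∈ U) :
    ∃ (F : Set (X → ℝ)) (ε : ℝ), F.Finite ∧ F ⊆ P ∧ 0 < ε ∧
      ∀ y, (∀ p ∈ F, p (y - x) < ε) → y ∈ U := by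
  induction hU with
  | basic U hU =>
    obtain ⟨z, F, ε, hF, hFP, hε, rfl⟩ := hU
    -- Finitely many strict inequalities at `x` leave a common slack `δ`, the radius of a ball
    -- around `x`.
    have : ∃ δ : ℝ, 0 < δ ∧ ∀ p ∈ F, p (x - z) + δ ≤ ε := by
      have hx' : ∀ p ∈ F, p (x - z) < ε := hx
      clear hx hFP
      induction F, hF using Set.Finite.induction_on with
      | empty => exact ⟨1, one_pos, by simp⟩
      | @insert p F _ _ ih =>
        obtain ⟨δ, hδ, h⟩ := ih fun q hq => hx' q (Set.mem_insert_of_mem _ hq)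
        have hp := hx' p (Set.mem_insert _ _)
        refine ⟨min δ (ε - p (x - z)), lt_min hδ (sub_pos.2 hp), ?_⟩
        rintro q (rfl | hq)
        · linarith [min_le_right δ (ε - q (x - z))]
        · linarith [min_le_left δ (ε - p (x - z)), h q hq]
    obtain ⟨δ, hδ, h⟩ := this
    refine ⟨F, δ, hF, hFP, hδ, fun y hy p hp => ?_⟩
    have := (hP p (hFP hp)).add_le (y - x) (x - z)
    rw [sub_add_sub_cancel] at this
    linarith [h p hp, hy p hp]
  | univ => exact ⟨∅, 1, Set.finite_empty, Set.empty_subset _, one_pos, fun _ _ => trivial⟩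
  | inter s t _ _ hs ht =>
    obtain ⟨F, ε, hF, hFP, hε, h⟩ := hs hx.1
    obtain ⟨G, δ, hG, hGP, hδ, h'⟩ := ht hx.2
    exact ⟨F ∪ G, min ε δ, hF.union hG, Set.union_subset hFP hGP, lt_min hε hδ, fun y hy =>
      ⟨h y fun p hp => (hy p (Or.inl hp)).trans_le (min_le_left _ _),
        h' y fun p hp => (hy p (Or.inr hp)).trans_le (min_le_right _ _)⟩⟩
  | sUnion S _ ih =>
    obtain ⟨s, hs, hxs⟩ := hx
    obtain ⟨F, ε, hF, hFP, hε, h⟩ := ih s hs hxs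
    exact ⟨F, ε, hF, hFP, hε, fun y hy => ⟨s, hs, h y hy⟩⟩

/-- Linearity gives `φ y - φ x ≤ p (y - x)`, so `φ` rises by less than the radius on a `p`-ball. -/
theorem mem_dualCone_of_le (hp : IsAsymmetricSeminorm p) (hpP : p ∈ P) {φ : Module.Dual ℝ X}
    (hφ : ∀ x, φ x ≤ p x) : φ ∈ dualCone (seminormTopology P) := by
  let _ := seminormTopology P
  intro x a hxa
  have hxa : φ x < a := hxa
  have hU : IsOpen {y | ∀ q ∈ ({p} : Set (X → ℝ)), q (y - x) < a - φ x} :=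
    TopologicalSpace.isOpen_generateFrom_of_mem
      ⟨x, {p}, _, Set.finite_singleton p, by simpa using hpP, sub_pos.2 hxa, rfl⟩
  filter_upwards [hU.mem_nhds (by simpa [hp.map_zero] using hxa)] with y hy
  have h1 : p (y - x) < a - φ x := hy p rfl
  have h2 := hφ (y - x)
  rw [map_sub] at h2
  linarith

theorem dualCone_anti {α β : TopologicalSpace X} (h : α ≤ β) : dualCone β ≤ dualCone α :=
  fun _ hφ x a hxa => nhds_mono h (hφ x a hxa)

theorem eq_zero_of_forall_dualCone {α : TopologicalSpace X} (hα : IsAsymmetricLocallyConvex α)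
    (hT : @T0Space X α) {x : X} (hx : ∀ φ ∈ dualCone α, φ x = 0) : x = 0 := by
  obtain ⟨P, hP, rfl⟩ := hα
  let _ := seminormTopology P
  have key : ∀ z : X, (∀ φ ∈ dualCone (seminormTopology P), φ z = 0) → ∀ p ∈ P, p z = 0 := by
    intro z hz p hp
    obtain ⟨φ, hφ, hφz⟩ := (hP p hp).exists_dual_eq z
    rw [← hφz, hz φ (mem_dualCone_of_le (hP p hp) hp hφ)]
  have h1 := key x hx
  -- Asymmetry makes `p x = 0` insufficient: `0` lies in all neighbourhoods of `x` because `p (-x) =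
  -- 0`.
  have h2 := key (-x) fun φ hφ => by rw [map_neg, hx φ hφ, neg_zero]
  apply hT.t0
  rw [inseparable_iff_forall_isOpen]
  refine fun U hU => ⟨fun hxU => ?_, fun h0U => ?_⟩
  · obtain ⟨F, ε, -, hF, hε, h⟩ := exists_subset_of_isOpen_seminormTopology hP hU hxU
    exact h 0 fun p hp => by rw [zero_sub, h2 p (hF hp)]; exact hε
  · obtain ⟨F, ε, -, hF, hε, h⟩ := exists_subset_of_isOpen_seminormTopology hP hU h0U
    exact h x fun p hp => by rw [sub_zero, h1 p (hF hp)]; exact hε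

end Seminorms

/-! ### Weak and Mackey topologies of a pairing. -/

section Pairing

variable {X Y : Type*} [AddCommGroup X] [Module ℝ X] [AddCommMonoid Y] [Module ℝ≥0 Y]
  (b : X →ₗ[ℝ] Y →ₗ[ℝ≥0] ℝ)

theorem flip_mem_dualCone_weakTopology (y : Y) : b.flip y ∈ dualCone (weakTopology b) :=
  mem_dualCone_of_le (isAsymmetricSeminorm_max_zero (b.flip y)) (Set.mem_range_self y) fun _ => le_max_left _ _

theorem le_weakTopology {α : TopologicalSpace X} (h : ∀ y, b.flip y ∈ dualCone α) :
    α ≤ weakTopology b := by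
  apply le_generateFrom
  rintro U ⟨x, F, ε, hF, hFP, hε, rfl⟩
  have : {y | ∀ p ∈ F, p (y - x) < ε} = ⋂ p ∈ F, {y | p (y - x) < ε} := by
    ext; simp
  rw [this]
  refine hF.isOpen_biInter fun p hp => ?_
  obtain ⟨y, rfl⟩ := hFP hp
  have hy : UpperSemicontinuous fun z => b.flip y z := h y
  convert hy.isOpen_preimage (b x y + ε) using 1
  ext z
  simp [hε, sub_lt_iff_lt_add']

theorem t0Space_weakTopology (hb : IsAsymmetricDualPair b) : @T0Space X (weakTopology b) := by
  let _ := weakTopology b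
  have key : ∀ x z : X, Inseparable x z → ∀ y, b x y ≤ b z y := by
    intro x z h y
    by_contra! hlt
    have hy : UpperSemicontinuous fun x => b.flip y x := flip_mem_dualCone_weakTopology b y
    have : b x y < b x y :=
      ((inseparable_iff_forall_isOpen.1 h) _ (hy.isOpen_preimage (b x y))).2 hlt
    exact lt_irrefl _ this
  refine ⟨fun x z h => sub_eq_zero.1 (hb.left _ fun y => ?_)⟩
  rw [map_sub, LinearMap.sub_apply, sub_eq_zero]
  exact (key x z h y).antisymm (key z x h.symm y)

theorem isInducing_weakStarTopology :
    @IsInducing Y (X → ℝ) (weakStarTopology b) _ fun y x => b x y :=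
  let _ := weakStarTopology b
  ⟨rfl⟩

theorem isAsymmetricSeminorm_polarSeminorm {B : Set Y}
    (hB : @IsCompact Y (weakStarTopology b) B) : IsAsymmetricSeminorm (polarSeminorm b B) := by
  have hbdd := bddAbove_of_isCompact b hB
  have hnonneg : ∀ x, 0 ≤ polarSeminorm b B x := by
    intro x
    apply Real.sSup_nonneg
    rintro _ ⟨y, -, rfl⟩
    exact le_max_right _ _
  refine ⟨hnonneg, fun r hr x => ?_, fun x z => ?_⟩
  · rw [polarSeminorm, polarSeminorm, ← smul_eq_mul, ← Real.sSup_smul_of_nonneg hr]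
    congr 1
    rw [← Set.image_smul, Set.image_image]
    refine Set.image_congr fun y _ => ?_
    exact (isAsymmetricSeminorm_max_zero (b.flip y)).smul r hr x
  · refine Real.sSup_le ?_ (add_nonneg (hnonneg x) (hnonneg z))
    rintro _ ⟨y, hy, rfl⟩
    exact ((isAsymmetricSeminorm_max_zero (b.flip y)).add_le x z).trans
      (add_le_add (le_csSup (hbdd x) ⟨y, hy, rfl⟩) (le_csSup (hbdd z) ⟨y, hy, rfl⟩))

theorem mackeyTopology_isAsymmetricSeminorm :
    ∀ p ∈ polarSeminorm b '' {B | Convex ℝ≥0 B ∧ @IsCompact Y (weakStarTopology b) B},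
      IsAsymmetricSeminorm p := by
  rintro _ ⟨B, hB, rfl⟩
  exact isAsymmetricSeminorm_polarSeminorm b hB.2

theorem isAsymmetricLocallyConvex_mackeyTopology :
    IsAsymmetricLocallyConvex (mackeyTopology b) :=
  ⟨_, mackeyTopology_isAsymmetricSeminorm b, rfl⟩

theorem mackeyTopology_le_weakTopology : mackeyTopology b ≤ weakTopology b := by
  apply seminormTopology_anti
  rintro _ ⟨y, rfl⟩
  -- Singletons are compact and convex, and `p_{y}` is the weak seminorm of `y`.
  refine ⟨{y}, ⟨convex_singleton y, @isCompact_singleton Y (weakStarTopology b) y⟩, ?_⟩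
  ext x
  simp [polarSeminorm]

/-- The Banach-Alaoglu theorem: the set of all elements of `Y` dominated by an asymmetric
seminorm is compact, if all linear functions dominated by that seminorm come from `Y`. -/
theorem isCompact_setOf_le {p : X → ℝ}
    (h : ∀ φ : Module.Dual ℝ X, (∀ x, φ x ≤ p x) → ∃ y, b.flip y = φ) :
    @IsCompact Y (weakStarTopology b) {y | ∀ x, b x y ≤ p x} := by
  let _ := weakStarTopology b
  rw [(isInducing_weakStarTopology b).isCompact_iff]
  -- The image consists of all linear functions in a Tychonoff product of intervals; the lower bound
  -- `-p (-x)` is domination at `-x`.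
  have himage : (fun (y : Y) (x : X) => b x y) '' {y | ∀ x, b x y ≤ p x} =
      (Set.univ.pi fun x => Set.Icc (-p (-x)) (p x)) ∩
        {f : X → ℝ | (∀ x z, f (x + z) = f x + f z) ∧ ∀ (r : ℝ) (x : X), f (r • x) = r * f x} := by
    ext f
    constructor
    · rintro ⟨y, hy, rfl⟩
      refine ⟨fun x _ => ⟨?_, hy x⟩, fun x z => ?_, fun r x => ?_⟩
      · have := hy (-x)
        rw [map_neg, LinearMap.neg_apply] at this
        linarith
      · simp
      · exact (b.flip y).map_smul r x
    · rintro ⟨hf, hadd, hsmul⟩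
      obtain ⟨y, hy⟩ := h { toFun := f, map_add' := hadd, map_smul' := hsmul }
        fun x => (hf x trivial).2
      have hy' : ∀ x, b x y = f x := fun x => congrArg (fun φ : Module.Dual ℝ X => φ x) hy
      exact ⟨y, fun x => (hy' x).trans_le (hf x trivial).2, funext hy'⟩
  rw [himage]
  refine (isCompact_univ_pi fun x => isCompact_Icc).inter_right (IsClosed.and ?_ ?_)
  · simp only [Set.ofPred_forall]
    exact isClosed_iInter fun x => isClosed_iInter fun z =>
      isClosed_eq (continuous_apply _) ((continuous_apply x).add (continuous_apply z))
  · simp only [Set.ofPred_forall]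
    exact isClosed_iInter fun r => isClosed_iInter fun x =>
      isClosed_eq (continuous_apply _) (continuous_const.mul (continuous_apply x))

theorem convex_setOf_le (p : X → ℝ) : Convex ℝ≥0 {y : Y | ∀ x, b x y ≤ p x} := by
  intro y hy z hz s t _ _ hst x
  have hst' : (s : ℝ) + t = 1 := by exact_mod_cast hst
  rw [map_add, map_smul, map_smul, NNReal.smul_def, NNReal.smul_def, smul_eq_mul, smul_eq_mul]
  calc (s : ℝ) * b x y + t * b x z ≤ s * p x + t * p x :=
        add_le_add (mul_le_mul_of_nonneg_left (hy x) s.2) (mul_le_mul_of_nonneg_left (hz x) t.2)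
    _ = p x := by rw [← add_mul, hst', one_mul]

theorem polarSeminorm_setOf_le {p : X → ℝ} (hp : IsAsymmetricSeminorm p)
    (h : ∀ φ : Module.Dual ℝ X, (∀ x, φ x ≤ p x) → ∃ y, b.flip y = φ) :
    polarSeminorm b {y | ∀ x, b x y ≤ p x} = p := by
  ext x
  have hle : ∀ r ∈ (fun y => max (b x y) 0) '' {y | ∀ x, b x y ≤ p x}, r ≤ p x := by
    rintro _ ⟨y, hy, rfl⟩
    exact max_le (hy x) (hp.nonneg x)
  apply le_antisymm (Real.sSup_le hle (hp.nonneg x))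
  obtain ⟨φ, hφ, hφx⟩ := hp.exists_dual_eq x
  obtain ⟨y, rfl⟩ := h φ hφ
  exact hφx.ge.trans ((le_max_left _ _).trans (le_csSup ⟨_, hle⟩ ⟨y, hφ, rfl⟩))

theorem mackeyTopology_le {α : TopologicalSpace X} (hα : IsAsymmetricLocallyConvex α)
    (h : ∀ φ ∈ dualCone α, ∃ y, b.flip y = φ) : mackeyTopology b ≤ α := by
  obtain ⟨P, hP, rfl⟩ := hα
  refine seminormTopology_anti fun p hp => ?_
  have hp' : ∀ φ : Module.Dual ℝ X, (∀ x, φ x ≤ p x) → ∃ y, b.flip y = φ :=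
    fun φ hφ => h φ (mem_dualCone_of_le (hP p hp) hp hφ)
  exact ⟨_, ⟨convex_setOf_le b p, isCompact_setOf_le b hp'⟩,
    polarSeminorm_setOf_le b (hP p hp) hp'⟩

/-! ### Separation in the algebraic dual. -/

/-- The algebraic dual of `X` with the topology of pointwise convergence. -/
abbrev WeakAlgebraicDual (X : Type*) [AddCommGroup X] [Module ℝ X] : Type _ :=
  WeakBilin (LinearMap.id : Module.Dual ℝ X →ₗ[ℝ] X →ₗ[ℝ] ℝ)

/-- The map from `Y` to the algebraic dual of `X` that is given by the pairing. -/
def toWeakAlgebraicDual (y : Y) : WeakAlgebraicDual X := b.flip y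

theorem continuous_toWeakAlgebraicDual :
    @Continuous Y (WeakAlgebraicDual X) (weakStarTopology b) _ (toWeakAlgebraicDual b) := by
  let _ := weakStarTopology b
  exact WeakBilin.continuous_of_continuous_eval _ fun x =>
    (continuous_apply x).comp (isInducing_weakStarTopology b).continuous

instance : T2Space (WeakAlgebraicDual X) :=
  (WeakBilin.isEmbedding (B := (LinearMap.id : Module.Dual ℝ X →ₗ[ℝ] X →ₗ[ℝ] ℝ))
    Function.injective_id).t2Space

theorem convex_image_toWeakAlgebraicDual {B : Set Y} (hB : Convex ℝ≥0 B) :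
    Convex ℝ (toWeakAlgebraicDual b '' B) := by
  rintro _ ⟨y, hy, rfl⟩ _ ⟨z, hz, rfl⟩ s t hs ht hst
  lift s to ℝ≥0 using hs
  lift t to ℝ≥0 using ht
  refine ⟨s • y + t • z, hB hy hz zero_le zero_le (by exact_mod_cast hst), ?_⟩
  change b.flip _ = (s : ℝ) • b.flip y + (t : ℝ) • b.flip z
  rw [map_add, map_smul, map_smul]
  rfl

/-- This is the join of `0` with `s`; inserting `0` matters only for empty `s`. -/
theorem convex_insert_zero_Icc_smul {E : Type*} [AddCommGroup E] [Module ℝ E] {s : Set E}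
    (hs : Convex ℝ s) : Convex ℝ (insert 0 (Set.Icc (0 : ℝ) 1 • s)) := by
  rcases s.eq_empty_or_nonempty with rfl | hne
  · simp
  · suffices insert 0 (Set.Icc (0 : ℝ) 1 • s) = convexJoin ℝ {0} s from
      this ▸ (convex_singleton 0).convexJoin hs
    ext x
    simp only [convexJoin_singleton_left, Set.mem_iUnion, segment_eq_image', Set.mem_smul,
      Set.mem_image, sub_zero, zero_add, exists_prop, Set.mem_insert_iff]
    constructor
    · rintro (rfl | ⟨t, ht, y, hy, rfl⟩)
      · obtain ⟨y, hy⟩ := hne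
        exact ⟨y, hy, 0, ⟨le_rfl, zero_le_one⟩, zero_smul _ _⟩
      · exact ⟨y, hy, t, ht, rfl⟩
    · rintro ⟨y, hy, t, ht, rfl⟩
      exact Or.inr ⟨t, ht, y, hy, rfl⟩

/-- `K` is the Minkowski sum of the joins of `0` with the finitely many sets `B`. Each summand
contains `0`, so `K` contains every `B`. -/
theorem exists_compact_convex_dominating {F : Set (X → ℝ)} (hF : F.Finite)
    (hFP : F ⊆ polarSeminorm b '' {B | Convex ℝ≥0 B ∧ @IsCompact Y (weakStarTopology b) B}) :
    ∃ K : Set (WeakAlgebraicDual X), Convex ℝ K ∧ IsCompact K ∧ 0 ∈ K ∧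
      K ⊆ Set.range (toWeakAlgebraicDual b) ∧
      ∀ (x : X) (u : ℝ), (∀ φ : Module.Dual ℝ X, φ ∈ K → φ x ≤ u) → ∀ p ∈ F, p x ≤ u := by
  let _ := weakStarTopology b
  induction F, hF using Set.Finite.induction_on with
  | empty =>
    refine ⟨{0}, convex_singleton 0, isCompact_singleton, rfl, ?_, by simp⟩
    rintro _ rfl
    exact ⟨0, map_zero b.flip⟩
  | @insert p F _ _ ih =>
    obtain ⟨K, hKconv, hKcomp, hK0, hKY, hK⟩ := ih ((Set.subset_insert _ _).trans hFP)
    obtain ⟨B, ⟨hBconv, hBcomp⟩, rfl⟩ := hFP (Set.mem_insert _ _)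
    set C : Set (WeakAlgebraicDual X) := Set.Icc (0 : ℝ) 1 • (toWeakAlgebraicDual b '' B)
    refine ⟨K + insert 0 C, hKconv.add (convex_insert_zero_Icc_smul
      (convex_image_toWeakAlgebraicDual b hBconv)), hKcomp.add ((isCompact_Icc.smul_set
        (hBcomp.image (continuous_toWeakAlgebraicDual b))).insert 0),
      ⟨0, hK0, 0, Set.mem_insert _ _, add_zero 0⟩, ?_, fun x u h => ?_⟩
    · rintro _ ⟨φ, hφ, ψ, rfl | hψ, rfl⟩
      · simpa using hKY hφ
      · obtain ⟨y, rfl⟩ := hKY hφ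
        obtain ⟨t, ht, _, ⟨z, -, rfl⟩, rfl⟩ := hψ
        lift t to ℝ≥0 using ht.1
        refine ⟨y + t • z, ?_⟩
        change b.flip _ = b.flip y + (t : ℝ) • b.flip z
        rw [map_add, map_smul]
        rfl
    · have hleft : ∀ φ : Module.Dual ℝ X, φ ∈ K → φ x ≤ u := fun φ hφ =>
        h φ ⟨φ, hφ, 0, Set.mem_insert _ _, add_zero φ⟩
      rintro q (rfl | hq)
      -- `0 ∈ K` forces `0 ≤ u`, which covers empty `B` and the truncation at `0`.
      · refine Real.sSup_le ?_ (hleft 0 hK0)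
        rintro _ ⟨y, hy, rfl⟩
        have hyC : toWeakAlgebraicDual b y ∈ C :=
          ⟨1, ⟨zero_le_one, le_rfl⟩, _, ⟨y, hy, rfl⟩, one_smul _ _⟩
        exact max_le (h _ ⟨0, hK0, _, Set.mem_insert_of_mem _ hyC, zero_add _⟩) (hleft 0 hK0)
      · exact hK x u hleft q hq

/-- Functionals continuous for pointwise convergence are evaluations, so the separating functional
is a point of `X`. -/
theorem exists_eval_of_notMem {K : Set (WeakAlgebraicDual X)} (hconv : Convex ℝ K)
    (hcomp : IsCompact K) {φ : Module.Dual ℝ X} (hφ : φ ∉ K) :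
    ∃ (x : X) (u : ℝ), (∀ ψ : Module.Dual ℝ X, ψ ∈ K → ψ x < u) ∧ u < φ x := by
  obtain ⟨f, u, hf, hu⟩ := geometric_hahn_banach_closed_point hconv hcomp.isClosed hφ
  obtain ⟨x, rfl⟩ := LinearMap.dualEmbedding_surjective _ f
  exact ⟨x, u, hf, hu⟩

theorem exists_flip_eq_of_mem_dualCone_mackeyTopology {φ : Module.Dual ℝ X}
    (hφ : φ ∈ dualCone (mackeyTopology b)) : ∃ y, b.flip y = φ := by
  have hopen : IsOpen[mackeyTopology b] {x | φ x < 1} := by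
    let _ := mackeyTopology b
    have hφ : UpperSemicontinuous fun x => φ x := hφ
    exact hφ.isOpen_preimage 1
  obtain ⟨F, ε, hF, hFP, hε, h⟩ := exists_subset_of_isOpen_seminormTopology
    (mackeyTopology_isAsymmetricSeminorm b) hopen (x := 0) (by simp)
  obtain ⟨K, hKconv, hKcomp, hK0, hKY, hK⟩ := exists_compact_convex_dominating b hF hFP
  -- Otherwise a separating `x`, scaled by `ε / (2 * u)`, has `p ≤ ε / 2 < ε` for all `p ∈ F`, yet
  -- `φ` exceeds 1 there.
  have hmem : (ε / 2) • φ ∈ K := by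
    by_contra hnot
    obtain ⟨x, u, hxK, hxφ⟩ := exists_eval_of_notMem hKconv hKcomp hnot
    have hu : 0 < u := hxK 0 hK0
    have hxφ : u < ε / 2 * φ x := hxφ
    have hc : 0 < ε / (2 * u) := by positivity
    have hlt : φ ((ε / (2 * u)) • x) < 1 := h _ fun p hp => by
      have hpx := hK x u (fun ψ hψ => (hxK ψ hψ).le) p hp
      rw [sub_zero, (mackeyTopology_isAsymmetricSeminorm b p (hFP hp)).smul _ hc.le]
      calc ε / (2 * u) * p x ≤ ε / (2 * u) * u := mul_le_mul_of_nonneg_left hpx hc.le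
        _ = ε / 2 := by field_simp
        _ < ε := half_lt_self hε
    rw [map_smul, smul_eq_mul, div_mul_eq_mul_div, div_lt_one (by positivity)] at hlt
    linarith
  obtain ⟨y, hy⟩ := hKY hmem
  have hy : b.flip y = (ε / 2) • φ := hy
  have hc : 0 ≤ 2 / ε := by positivity
  refine ⟨(2 / ε).toNNReal • y, ?_⟩
  rw [map_smul, hy, NNReal.smul_def, Real.coe_toNNReal _ hc]
  rw [smul_smul, div_mul_div_cancel₀ hε.ne', div_self two_ne_zero, one_smul]

theorem hasDual_of_le (hb : IsAsymmetricDualPair b) {α : TopologicalSpace X}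
    (h1 : α ≤ weakTopology b) (h2 : mackeyTopology b ≤ α) : HasDual b α := by
  refine ⟨fun φ hφ => ?_, fun y => dualCone_anti h1 (flip_mem_dualCone_weakTopology b y)⟩
  obtain ⟨y, rfl⟩ := exists_flip_eq_of_mem_dualCone_mackeyTopology b (dualCone_anti h2 hφ)
  exact ⟨y, rfl, fun z hz => hb.right z y fun x => LinearMap.congr_fun hz x⟩

end Pairing

end AsymDuality

/- In Mathlib's order on topologies, `s ≤ t` says that `s` is finer than `t`, i.e. that every
`t`-open set is `s`-open; so the finest topology of a collection is its least element. -/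
theorem mainTheorem6 {X : Type*} [AddCommGroup X] [Module ℝ X] :
    (∀ (Y : Type*) [AddCommMonoid Y] [Module ℝ≥0 Y] (b : X →ₗ[ℝ] Y →ₗ[ℝ≥0] ℝ),
      AsymDuality.IsAsymmetricDualPair b →
        IsLeast {α : TopologicalSpace X | AsymDuality.IsAsymmetricLocallyConvex α ∧
          @T0Space X α ∧ AsymDuality.HasDual b α} (AsymDuality.mackeyTopology b) ∧
        ∀ α : TopologicalSpace X, AsymDuality.IsAsymmetricLocallyConvex α → @T0Space X α →
          α ≤ AsymDuality.weakTopology b → AsymDuality.mackeyTopology b ≤ α →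
            AsymDuality.HasDual b α) ∧
    (∀ α : TopologicalSpace X, AsymDuality.IsAsymmetricLocallyConvex α → @T0Space X α →
      AsymDuality.IsAsymmetricDualPair (AsymDuality.evalPairing α) ∧
        α ≤ AsymDuality.weakTopology (AsymDuality.evalPairing α) ∧
        AsymDuality.mackeyTopology (AsymDuality.evalPairing α) ≤ α) := by
  refine ⟨fun Y _ _ b hb => ?_, fun α hα hT => ?_⟩
  · have hle := AsymDuality.mackeyTopology_le_weakTopology b
    refine ⟨⟨⟨AsymDuality.isAsymmetricLocallyConvex_mackeyTopology b,
      AsymDuality.T0Space.of_le hle (AsymDuality.t0Space_weakTopology b hb),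
      AsymDuality.hasDual_of_le b hb hle le_rfl⟩, fun α hα => ?_⟩,
      fun α _ _ h1 h2 => AsymDuality.hasDual_of_le b hb h1 h2⟩
    exact AsymDuality.mackeyTopology_le b hα.1 fun φ hφ => (hα.2.2.1 φ hφ).exists
  · refine ⟨⟨fun x hx => ?_, fun φ ψ h => ?_⟩, ?_, ?_⟩
    · exact AsymDuality.eq_zero_of_forall_dualCone hα hT fun φ hφ => hx ⟨φ, hφ⟩
    · exact Subtype.ext (LinearMap.ext h)
    · exact AsymDuality.le_weakTopology _ fun φ => φ.2
    · exact AsymDuality.mackeyTopology_le _ hα fun φ hφ => ⟨⟨φ, hφ⟩, rfl⟩
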